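/- Let $\mathcal X\subset\mathbb R^n$ be closed and let $c:\mathbb R^n\to\mathbb R^p$ be locally Lipschitz and differentiable, with locally Lipschitz gradient $\nabla c(x)=[\nabla c_1(x),\dots,\nabla c_p(x)]\in\mathbb R^{n\times p}$. Put $\mathcal K=\{x\in\mathcal X: c(x)=0\}$, let $\Pi_{\mathcal X}(z)$ be the set of all nearest points of $\mathcal X$ to $z$, let $\mathcal T_{\mathcal X}(x)$ be the Clarke tangent cone of $\mathcal X$ at $x$, let $\mathcal N_{\mathcal X}(x)$ be the limiting (Mordukhovich) normal cone, and let $\mathrm{lin}(C)=C\cap(-C)$. Let $Q:\mathcal X\to\mathbb R^{n\times n}$ be a projective mapping, that is: $Q$ is continuous on $\mathcal X$; for every $x\in\mathcal X$ the matrix $Q(x)$ is symmetric positive semidefinite and its null space is the linear span of $\mathcal N_{\mathcal X}(x)$; and there is a locally bounded function $\rho:\mathcal X\to[0,\infty)$ with $\mathrm{dist}(x+Q(x)d,\mathcal X)\le\rho(x)\|d\|^2$ for all $x\in\mathcal X$ and $\|d\|\le1$. Let $\tau:[0,\infty)\to[0,\infty)$ be locally Lipschitz and strictly increasing with $\tau(0)=0$,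 and let $\xi:\mathbb R^n\to[0,\infty)$ be bounded on compact sets. Assume that the nondegeneracy condition $$\nabla c(x)^\top\,\mathrm{lin}(\mathcal T_{\mathcal X}(x))=\mathbb R^p$$ holds at every $x\in\mathcal X$. Given $\kappa\in(0,1)$, $\eta_{\max}>0$ and $\alpha\in(0,1)$, the hybrid method starts at some $x_0\in\mathcal X$ and proceeds as follows for $k=0,1,2,\dots$. Set $$d_k=Q(x_k)\nabla c(x_k)\bigl(\nabla c(x_k)^\top Q(x_k)\nabla c(x_k)+\tau(\|c(x_k)\|)I_p\bigr)^{-1}c(x_k)$$ and take any $x_{\mathrm{trial},k}\in\Pi_{\mathcal X}(x_k-d_k+r_k)$, where the error $r_k\in\mathbb R^n$ satisfies $\|r_k\|\le\xi(x_k)\|c(x_k)\|^2$. If $\|c(x_{\mathrm{trial},k})\|<(1-\kappa)\|c(x_k)\|$, set $x_{k+1}=x_{\mathrm{trial},k}$. Otherwise set $x_{k+1}=z_{j}$, where $z_i\in\Pi_{\mathcal X}(x_k-\alpha^i\eta_{\max}\nabla c(x_k)c(x_k))$ is any candidate for the exponent $i$, and $j\ge 0$ is the smallest exponent with $$\tfrac12\|c(z_j)\|^2\le\tfrac12\|c(x_k)\|^2-\frac1{4\alpha^j\eta_{\max}}\|z_j-x_k\|^2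 .$$ Then there is a function $C:\mathbb R^n\to\mathbb R$, depending only on $\mathcal X,c,Q,\tau,\xi$, such that every sequence $\{x_k\}$ generated by this method (for any $\kappa,\eta_{\max},\alpha$, any errors and any choice of the nearest points) that has at least one cluster point (for instance, every bounded one) converges to some $x^*\in\mathcal K$, and does so at a quadratic rate: for all sufficiently large $k$, $$\|x_{k+1}-x^*\|\le C(x^*)\|x_k-x^*\|^2\quad\text{and}\quad \mathrm{dist}(x_{k+1},\mathcal K)\le C(x^*)\,\mathrm{dist}(x_k,\mathcal K)^2 .$$ -/

import Mathlib

open Filter Topology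
open scoped NNReal InnerProductSpace

/-- The (possibly multivalued) projection `Π_X(z)`: the set of all nearest points of `X` to `z`. -/
def nearestPoints {n : ℕ} (X : Set (EuclideanSpace ℝ (Fin n))) (z : EuclideanSpace ℝ (Fin n)) :
    Set (EuclideanSpace ℝ (Fin n)) :=
  {y | y ∈ X ∧ ∀ y' ∈ X, ‖z - y‖ ≤ ‖z - y'‖}

/-- The Clarke tangent cone of `X` at `x`, i.e. the inner limit of `(X - x') / t` as `t ↓ 0` and
`x' → x` within `X`: the vectors `w` whose distance to `(X - x') / t` tends to `0`. -/
def clarkeTangentCone {n : ℕ} (X : Set (EuclideanSpace ℝ (Fin n)))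
    (x : EuclideanSpace ℝ (Fin n)) : Set (EuclideanSpace ℝ (Fin n)) :=
  {w | Tendsto
    (fun q : EuclideanSpace ℝ (Fin n) × ℝ => Metric.infDist w {v | q.1 + q.2 • v ∈ X})
    (𝓝[X] x ×ˢ 𝓝[>] (0 : ℝ)) (𝓝 0)}

/-- The lineality space `lin(K) = K ∩ (-K)` of a cone `K`. -/
def linealitySpace {n : ℕ} (K : Set (EuclideanSpace ℝ (Fin n))) :
    Set (EuclideanSpace ℝ (Fin n)) :=
  {w | w ∈ K ∧ -w ∈ K}

/-- The regular (Fréchet) normal cone of `X` at `x`: the vectors `v` such that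
`⟨v, x' - x⟩ ≤ o(‖x' - x‖)` as `x' → x` within `X`. -/
def regularNormalCone {n : ℕ} (X : Set (EuclideanSpace ℝ (Fin n)))
    (x : EuclideanSpace ℝ (Fin n)) : Set (EuclideanSpace ℝ (Fin n)) :=
  {v | ∀ ε > 0, ∀ᶠ x' in 𝓝[X] x, ⟪v, x' - x⟫_ℝ ≤ ε * ‖x' - x‖}

/-- The limiting (Mordukhovich) normal cone of `X` at `x`: the limits of regular normals to `X`
at points of `X` that converge to `x`. -/
def limitingNormalCone {n : ℕ} (X : Set (EuclideanSpace ℝ (Fin n)))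
    (x : EuclideanSpace ℝ (Fin n)) : Set (EuclideanSpace ℝ (Fin n)) :=
  {v | ∃ (y : ℕ → EuclideanSpace ℝ (Fin n)) (u : ℕ → EuclideanSpace ℝ (Fin n)),
    (∀ i, y i ∈ X) ∧ (∀ i, u i ∈ regularNormalCone X (y i)) ∧
    Tendsto y atTop (𝓝 x) ∧ Tendsto u atTop (𝓝 v)}

/-- The gradient `∇c(x) = [∇c₁(x), …, ∇cₚ(x)]`, an `n × p` matrix, as a linear map from `ℝᵖ`
to `ℝⁿ`: the transpose of the derivative of `c` at `x`. -/
noncomputable def grad {n p : ℕ}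
    (c : EuclideanSpace ℝ (Fin n) → EuclideanSpace ℝ (Fin p)) (x : EuclideanSpace ℝ (Fin n)) :
    EuclideanSpace ℝ (Fin p) →L[ℝ] EuclideanSpace ℝ (Fin n) :=
  ContinuousLinearMap.adjoint (fderiv ℝ c x)

/-- The nondegeneracy condition at `x`: `∇c(x)ᵀ lin(T_X(x)) = ℝᵖ`. -/
def Nondegenerate {n p : ℕ} (X : Set (EuclideanSpace ℝ (Fin n)))
    (c : EuclideanSpace ℝ (Fin n) → EuclideanSpace ℝ (Fin p))
    (x : EuclideanSpace ℝ (Fin n)) : Prop :=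
  (fun w => ContinuousLinearMap.adjoint (grad c x) w) ''
    linealitySpace (clarkeTangentCone X x) = Set.univ

/-- `Q` is a projective mapping for `X`. An `n × n` matrix is regarded as a linear operator on
`ℝⁿ`, and only the values of `Q` and `ρ` on `X` matter. -/
structure IsProjectiveMapping {n : ℕ} (X : Set (EuclideanSpace ℝ (Fin n)))
    (Q : EuclideanSpace ℝ (Fin n) →
      (EuclideanSpace ℝ (Fin n) →L[ℝ] EuclideanSpace ℝ (Fin n))) : Prop where
  continuousOn : ContinuousOn Q X
  posSemidef : ∀ x ∈ X, (Q x).IsPositive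
  null_eq : ∀ x ∈ X,
    LinearMap.ker (Q x : EuclideanSpace ℝ (Fin n) →ₗ[ℝ] EuclideanSpace ℝ (Fin n)) =
      Submodule.span ℝ (limitingNormalCone X x)
  dist_le : ∃ ρ : EuclideanSpace ℝ (Fin n) → ℝ≥0,
    (∀ S ⊆ X, IsCompact S → BddAbove (ρ '' S)) ∧
    ∀ x ∈ X, ∀ d, ‖d‖ ≤ 1 → Metric.infDist (x + Q x d) X ≤ ρ x * ‖d‖ ^ 2

/-- The regularized normal matrix `∇c(x)ᵀ Q(x) ∇c(x) + τ(‖c(x)‖) Iₚ`. -/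
noncomputable def normalMatrix {n p : ℕ}
    (c : EuclideanSpace ℝ (Fin n) → EuclideanSpace ℝ (Fin p))
    (Q : EuclideanSpace ℝ (Fin n) →
      (EuclideanSpace ℝ (Fin n) →L[ℝ] EuclideanSpace ℝ (Fin n)))
    (τ : ℝ≥0 → ℝ≥0) (x : EuclideanSpace ℝ (Fin n)) :
    EuclideanSpace ℝ (Fin p) →L[ℝ] EuclideanSpace ℝ (Fin p) :=
  ContinuousLinearMap.adjoint (grad c x) ∘L Q x ∘L grad c x +
    (τ ‖c x‖₊ : ℝ) • ContinuousLinearMap.id ℝ (EuclideanSpace ℝ (Fin p))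

/-- The direction
`d_k = Q(x) ∇c(x) (∇c(x)ᵀ Q(x) ∇c(x) + τ(‖c(x)‖) Iₚ)⁻¹ c(x)` computed at the iterate `x`. -/
noncomputable def newtonDirection {n p : ℕ}
    (c : EuclideanSpace ℝ (Fin n) → EuclideanSpace ℝ (Fin p))
    (Q : EuclideanSpace ℝ (Fin n) →
      (EuclideanSpace ℝ (Fin n) →L[ℝ] EuclideanSpace ℝ (Fin n)))
    (τ : ℝ≥0 → ℝ≥0) (x : EuclideanSpace ℝ (Fin n)) : EuclideanSpace ℝ (Fin n) :=
  Q x (grad c x ((normalMatrix c Q τ x).inverse (c x)))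

/-- The sufficient decrease test of the line search for the stepsize `η` and the candidate `z`. -/
def SufficientDecrease {n p : ℕ}
    (c : EuclideanSpace ℝ (Fin n) → EuclideanSpace ℝ (Fin p))
    (η : ℝ) (x z : EuclideanSpace ℝ (Fin n)) : Prop :=
  1 / 2 * ‖c z‖ ^ 2 ≤ 1 / 2 * ‖c x‖ ^ 2 - 1 / (4 * η) * ‖z - x‖ ^ 2

/-- `x'` is produced from `x` by a projected gradient step with backtracking: `z i` is the
candidate in `Π_X(x - αⁱ ηmax ∇c(x) c(x))` that is computed for the exponent `i`, and `j` is the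
smallest exponent whose candidate passes the sufficient decrease test. -/
def IsProjectedGradientStep {n p : ℕ} (X : Set (EuclideanSpace ℝ (Fin n)))
    (c : EuclideanSpace ℝ (Fin n) → EuclideanSpace ℝ (Fin p))
    (ηmax α : ℝ) (x x' : EuclideanSpace ℝ (Fin n)) : Prop :=
  ∃ (j : ℕ) (z : ℕ → EuclideanSpace ℝ (Fin n)),
    (∀ i ≤ j, z i ∈ nearestPoints X (x - (α ^ i * ηmax) • grad c x (c x))) ∧
    SufficientDecrease c (α ^ j * ηmax) x (z j) ∧
    (∀ i < j, ¬ SufficientDecrease c (α ^ i * ηmax) x (z i)) ∧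
    x' = z j

/-- `x` is a sequence of iterates of the hybrid method with evaluation errors `r`. The trial point
is any nearest point; it is accepted when it reduces `‖c‖` by the factor `1 - κ`, and otherwise a
projected gradient step is taken. -/
structure IsHybridSequence {n p : ℕ} (X : Set (EuclideanSpace ℝ (Fin n)))
    (c : EuclideanSpace ℝ (Fin n) → EuclideanSpace ℝ (Fin p))
    (Q : EuclideanSpace ℝ (Fin n) →
      (EuclideanSpace ℝ (Fin n) →L[ℝ] EuclideanSpace ℝ (Fin n)))
    (τ : ℝ≥0 → ℝ≥0) (ξ : EuclideanSpace ℝ (Fin n) → ℝ≥0) (κ ηmax α : ℝ)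
    (r x : ℕ → EuclideanSpace ℝ (Fin n)) : Prop where
  init : x 0 ∈ X
  error_le : ∀ k, ‖r k‖ ≤ ξ (x k) * ‖c (x k)‖ ^ 2
  step : ∀ k, ∃ xtrial ∈ nearestPoints X (x k - newtonDirection c Q τ (x k) + r k),
    (‖c xtrial‖ ≥ (1 - κ) * ‖c (x k)‖ →
      IsProjectedGradientStep X c ηmax α (x k) (x (k + 1))) ∧
    (‖c xtrial‖ < (1 - κ) * ‖c (x k)‖ → x (k + 1) = xtrial)

/-! Limiting normals are polar to Clarke tangents, so vectors in the lineality space are orthogonal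
to the span of the normals. Nondegeneracy therefore says that `grad c x` sends only `0` into that
span. This is used twice.

Globally, `‖c (x k)‖` decreases to a limit. If trial points are accepted infinitely often, the
factor `1 - κ` forces the limit to be `0`. Otherwise only gradient steps remain; line-search
stepsizes are bounded below near a cluster point `a`, so `-grad c a (c a)` is a limiting normal and
`c a = 0`.

Locally, `ker Q` is the span of the normals, so the normal matrix is invertible even where `τ`
vanishes. The trial step is then a perturbed Gauss-Newton step: it has length `O(‖c x‖)` and leaves
a residual `O(‖c x‖²)`, since projection, evaluation error and regularization each contribute `O(‖c
x‖²)`. Hence trial points near `a` are accepted whenever the residual is small and nonzero,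
residuals at least halve, and summing increments gives convergence with `‖x k - a‖ = O(‖c (x k)‖)`.
Both rates follow from `‖c (x k)‖ ≤ G * ‖x k - y‖` for feasible `y` near `a`; no error bound for the
distance to the feasible set is needed. -/

/-! ### Normals, tangents and nondegeneracy -/

/-- A regular normal at a point of `X` has nonpositive inner product, up to `ε`, with a vector that
is approximated up to `ε` by feasible directions at that point. -/
lemma inner_le_of_mem_regularNormalCone {n : ℕ} {X : Set (EuclideanSpace ℝ (Fin n))}
    {y u w : EuclideanSpace ℝ (Fin n)} {ε : ℝ} (hu : u ∈ regularNormalCone X y)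
    (h : ∀ᶠ t in 𝓝[>] (0 : ℝ), ∃ w', y + t • w' ∈ X ∧ ‖w - w'‖ ≤ ε) :
    ⟪u, w⟫_ℝ ≤ ε * ‖u‖ := by
  have hε : 0 ≤ ε := by
    obtain ⟨t, w', -, hw'⟩ := h.exists
    exact (norm_nonneg _).trans hw'
  refine le_of_forall_pos_le_add fun e he => ?_
  have hM : 0 < ‖w‖ + ε + 1 := by positivity
  have h1 := hu (e / (‖w‖ + ε + 1)) (by positivity)
  rw [eventually_nhdsWithin_iff, Metric.eventually_nhds_iff] at h1
  obtain ⟨δ, hδ, h1⟩ := h1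
  have h2 : ∀ᶠ t in 𝓝[>] (0 : ℝ), t ∈ Set.Ioo 0 (δ / (‖w‖ + ε + 1)) :=
    Ioo_mem_nhdsGT (by positivity)
  obtain ⟨t, ⟨w', hX, hw'⟩, ht0, htδ⟩ := (h.and h2).exists
  have hw'n : ‖w'‖ ≤ ‖w‖ + ε := by
    have := norm_sub_norm_le w' w
    rw [norm_sub_rev] at this
    linarith
  have ht : t * (‖w‖ + ε + 1) < δ := by rwa [lt_div_iff₀ hM] at htδ
  have hnorm : ‖y + t • w' - y‖ = t * ‖w'‖ := by
    rw [add_sub_cancel_left, norm_smul, Real.norm_of_nonneg ht0.le]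
  have h3 := h1 (y := y + t • w') (by
    rw [dist_eq_norm, hnorm]
    exact lt_of_le_of_lt (mul_le_mul_of_nonneg_left (by linarith) ht0.le) ht) hX
  rw [hnorm, add_sub_cancel_left, real_inner_smul_right] at h3
  have h4 : ⟪u, w'⟫_ℝ ≤ e / (‖w‖ + ε + 1) * ‖w'‖ := by
    refine le_of_mul_le_mul_left ?_ ht0
    linarith
  have h5 : e / (‖w‖ + ε + 1) * ‖w'‖ ≤ e := by
    rw [div_mul_eq_mul_div, div_le_iff₀ hM]
    exact mul_le_mul_of_nonneg_left (by linarith) he.le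
  have h6 : ⟪u, w - w'⟫_ℝ ≤ ε * ‖u‖ := by
    refine (real_inner_le_norm _ _).trans ?_
    rw [mul_comm]
    exact mul_le_mul_of_nonneg_right hw' (norm_nonneg _)
  rw [inner_sub_right] at h6
  linarith

/-- Limiting normals have nonpositive inner product with Clarke tangents. -/
lemma inner_nonpos_of_mem_clarkeTangentCone {n : ℕ} {X : Set (EuclideanSpace ℝ (Fin n))}
    {x v w : EuclideanSpace ℝ (Fin n)} (hv : v ∈ limitingNormalCone X x)
    (hw : w ∈ clarkeTangentCone X x) : ⟪v, w⟫_ℝ ≤ 0 := by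
  obtain ⟨y, u, hy, hu, hyx, huv⟩ := hv
  have key : ∀ ε > 0, ⟪v, w⟫_ℝ ≤ ε * ‖v‖ := by
    intro ε hε
    have h1 : ∀ᶠ q in 𝓝[X] x ×ˢ 𝓝[>] (0 : ℝ),
        Metric.infDist w {v | q.1 + q.2 • v ∈ X} < ε := hw.eventually_lt_const hε
    have h2 : Tendsto y atTop (𝓝[X] x) :=
      tendsto_nhdsWithin_iff.2 ⟨hyx, Eventually.of_forall hy⟩
    -- Currying the product filter fixes the base point `y i` before `t ↓ 0`, as the regular normal
    -- at `y i` requires.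
    have h3 := h2.eventually h1.curry
    refine le_of_tendsto_of_tendsto (huv.inner tendsto_const_nhds)
      (huv.norm.const_mul ε) ?_
    filter_upwards [h3] with i hi
    refine inner_le_of_mem_regularNormalCone (hu i) ?_
    filter_upwards [hi] with t ht
    rw [Metric.infDist_lt_iff ⟨0, by simpa using hy i⟩] at ht
    obtain ⟨w', hw', hd⟩ := ht
    exact ⟨w', hw', by rw [← dist_eq_norm]; exact hd.le⟩
  have h0 : Tendsto (fun ε : ℝ => ε * ‖v‖) (𝓝[>] 0) (𝓝 0) := by
    have : Tendsto (fun ε : ℝ => ε * ‖v‖) (𝓝 0) (𝓝 (0 * ‖v‖)) := by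
      exact tendsto_id.mul_const _
    rw [zero_mul] at this
    exact this.mono_left nhdsWithin_le_nhds
  exact ge_of_tendsto h0 (eventually_nhdsWithin_of_forall key)

lemma inner_eq_zero_of_mem_linealitySpace {n : ℕ} {X : Set (EuclideanSpace ℝ (Fin n))}
    {x v w : EuclideanSpace ℝ (Fin n)} (hv : v ∈ Submodule.span ℝ (limitingNormalCone X x))
    (hw : w ∈ linealitySpace (clarkeTangentCone X x)) : ⟪v, w⟫_ℝ = 0 := by
  induction hv using Submodule.span_induction with
  | mem v hv =>
    have h1 := inner_nonpos_of_mem_clarkeTangentCone hv hw.1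
    have h2 := inner_nonpos_of_mem_clarkeTangentCone hv hw.2
    rw [inner_neg_right] at h2
    linarith
  | zero => simp
  | add a b _ _ ha hb => rw [inner_add_left, ha, hb, add_zero]
  | smul t a _ ha => rw [real_inner_smul_left, ha, mul_zero]

/-- Writing `y` as the image of a lineality vector `w` gives `⟪y, y⟫ = ⟪grad c x y, w⟫ = 0`. This is
the only form in which nondegeneracy is used. -/
lemma Nondegenerate.eq_zero {n p : ℕ} {X : Set (EuclideanSpace ℝ (Fin n))}
    {c : EuclideanSpace ℝ (Fin n) → EuclideanSpace ℝ (Fin p)} {x : EuclideanSpace ℝ (Fin n)}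
    (h : Nondegenerate X c x) {y : EuclideanSpace ℝ (Fin p)}
    (hy : grad c x y ∈ Submodule.span ℝ (limitingNormalCone X x)) : y = 0 := by
  have hmem : y ∈ (fun w => ContinuousLinearMap.adjoint (grad c x) w) ''
      linealitySpace (clarkeTangentCone X x) := by
    rw [show _ = Set.univ from h]; trivial
  obtain ⟨w, hw, hwy⟩ := hmem
  have h1 := inner_eq_zero_of_mem_linealitySpace hy hw
  change ContinuousLinearMap.adjoint (grad c x) w = y at hwy
  rw [← ContinuousLinearMap.adjoint_inner_right, hwy] at h1
  exact inner_self_eq_zero.1 h1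

/-- The direction from a nearest point to the projected point is a regular normal. -/
lemma smul_sub_mem_regularNormalCone {n : ℕ} {X : Set (EuclideanSpace ℝ (Fin n))}
    {a z : EuclideanSpace ℝ (Fin n)} (hz : z ∈ nearestPoints X a) {s : ℝ} (hs : 0 ≤ s) :
    s • (a - z) ∈ regularNormalCone X z := by
  intro ε hε
  have h1 : ∀ᶠ x' in 𝓝[X] z, x' ∈ Metric.ball z (ε / (s + 1)) :=
    mem_nhdsWithin_of_mem_nhds (Metric.ball_mem_nhds _ (by positivity))
  filter_upwards [h1, self_mem_nhdsWithin] with x' hx' hX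
  have h2 := hz.2 x' hX
  have h3 : ‖a - x'‖ ^ 2 = ‖a - z‖ ^ 2 - 2 * ⟪a - z, x' - z⟫_ℝ + ‖x' - z‖ ^ 2 := by
    rw [← norm_sub_sq_real, sub_sub_sub_cancel_right]
  have h4 : ‖a - z‖ ^ 2 ≤ ‖a - x'‖ ^ 2 := by gcongr
  rw [Metric.mem_ball, dist_eq_norm, lt_div_iff₀ (by positivity)] at hx'
  rw [real_inner_smul_left]
  have h5 : 2 * ⟪a - z, x' - z⟫_ℝ ≤ ‖x' - z‖ ^ 2 := by linarith
  have h6 : s * (2 * ⟪a - z, x' - z⟫_ℝ) ≤ s * ‖x' - z‖ ^ 2 := mul_le_mul_of_nonneg_left h5 hs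
  have h7 : s * ‖x' - z‖ ≤ ε := by nlinarith [norm_nonneg (x' - z)]
  nlinarith [mul_le_mul_of_nonneg_right h7 (norm_nonneg (x' - z)), norm_nonneg (x' - z)]

/-! ### Taylor estimates and the line search -/

/-- Uniform first- and second-order estimates for a map with locally Lipschitz gradient. -/
lemma exists_local_taylor_bounds {n p : ℕ}
    {c : EuclideanSpace ℝ (Fin n) → EuclideanSpace ℝ (Fin p)}
    (hc : LocallyLipschitz c) (hc_diff : Differentiable ℝ c)
    (hc_grad : LocallyLipschitz (grad c)) (a : EuclideanSpace ℝ (Fin n)) :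
    ∃ δ > 0, ∃ G ≥ 0, ∃ L ≥ 0,
      (∀ x ∈ Metric.ball a δ, ‖c x‖ ≤ ‖c a‖ + 1 ∧ ‖grad c x‖ ≤ ‖grad c a‖ + 1) ∧
      ∀ x ∈ Metric.ball a δ, ∀ z ∈ Metric.ball a δ,
        ‖c z - c x‖ ≤ G * ‖z - x‖ ∧ ‖c z - c x - fderiv ℝ c x (z - x)‖ ≤ L * ‖z - x‖ ^ 2 := by
  obtain ⟨G, s, hs, hG⟩ := hc a
  obtain ⟨L, t, ht, hL⟩ := hc_grad a
  have hb1 : ∀ᶠ x in 𝓝 a, ‖c x‖ < ‖c a‖ + 1 :=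
    hc.continuous.norm.continuousAt.eventually_lt_const (by linarith)
  have hb2 : ∀ᶠ x in 𝓝 a, ‖grad c x‖ < ‖grad c a‖ + 1 :=
    hc_grad.continuous.norm.continuousAt.eventually_lt_const (by linarith)
  obtain ⟨δ, hδ, hball⟩ := Metric.mem_nhds_iff.1
    (inter_mem (inter_mem hs ht) (inter_mem hb1 hb2))
  refine ⟨δ, hδ, G, G.2, L, L.2, fun x hx => ⟨le_of_lt (hball hx).2.1, le_of_lt (hball hx).2.2⟩,
    fun x hx z hz => ⟨?_, ?_⟩⟩
  · simpa [dist_eq_norm] using hG.dist_le_mul z (hball hz).1.1 x (hball hx).1.1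
  · have hseg : segment ℝ x z ⊆ Metric.ball a δ := (convex_ball a δ).segment_subset hx hz
    have h1 : ∀ y ∈ segment ℝ x z, ‖fderiv ℝ c y - fderiv ℝ c x‖ ≤ L * ‖z - x‖ := by
      intro y hy
      have h2 := hL.dist_le_mul y (hball (hseg hy)).1.2 x (hball hx).1.2
      rw [dist_eq_norm, dist_eq_norm, grad, grad, ← map_sub, LinearIsometryEquiv.norm_map] at h2
      refine h2.trans (mul_le_mul_of_nonneg_left ?_ L.2)
      rw [← dist_eq_norm, ← dist_eq_norm, dist_comm y x, dist_comm z x]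
      have := dist_add_dist_of_mem_segment hy
      linarith [dist_nonneg (x := y) (y := z)]
    have h3 := (convex_segment x z).norm_image_sub_le_of_norm_hasFDerivWithin_le'
      (φ := fderiv ℝ c x)
      (fun y _ => (hc_diff y).hasFDerivAt.hasFDerivWithinAt) h1
      (left_mem_segment ℝ x z) (right_mem_segment ℝ x z)
    calc _ ≤ _ := h3
      _ = _ := by ring

lemma inner_grad_left {n p : ℕ} (c : EuclideanSpace ℝ (Fin n) → EuclideanSpace ℝ (Fin p))
    (x w : EuclideanSpace ℝ (Fin n)) (y : EuclideanSpace ℝ (Fin p)) :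
    ⟪grad c x y, w⟫_ℝ = ⟪y, fderiv ℝ c x w⟫_ℝ :=
  ContinuousLinearMap.adjoint_inner_left _ _ _

/-- Near any point, every sufficiently small stepsize passes the sufficient decrease test. -/
lemma exists_sufficientDecrease {n p : ℕ} {X : Set (EuclideanSpace ℝ (Fin n))}
    {c : EuclideanSpace ℝ (Fin n) → EuclideanSpace ℝ (Fin p)}
    (hc : LocallyLipschitz c) (hc_diff : Differentiable ℝ c)
    (hc_grad : LocallyLipschitz (grad c)) (a : EuclideanSpace ℝ (Fin n)) :
    ∃ δ > 0, ∃ ηlow > 0, ∀ x ∈ X, x ∈ Metric.ball a δ → ∀ η, 0 < η → η ≤ ηlow →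
      ∀ z ∈ nearestPoints X (x - η • grad c x (c x)), SufficientDecrease c η x z := by
  obtain ⟨δ, hδ, G, hG, L, hL, hb, hT⟩ := exists_local_taylor_bounds hc hc_diff hc_grad a
  -- `M` collects the Taylor remainder paired with `c x` and the square term `‖c z - c x‖ ^ 2 / 2`.
  set M := (‖c a‖ + 1) * L + G ^ 2 / 2 with hM
  set g := (‖grad c a‖ + 1) * (‖c a‖ + 1) with hg
  have hM0 : 0 ≤ M := by positivity
  have hg0 : 0 < g := by positivity
  -- The first bound on `η` gives `M ≤ 1 / (4 * η)`; the second keeps `z` within `δ / 2` of `x`,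
  -- inside the Taylor ball.
  refine ⟨δ / 2, by positivity, min (1 / (4 * (M + 1))) (δ / (4 * g)),
    lt_min (by positivity) (by positivity), ?_⟩
  intro x hxX hx η hη hηle z hz
  have hη1 : η * (4 * (M + 1)) ≤ 1 := (le_div_iff₀ (by positivity)).1 (hηle.trans (min_le_left _ _))
  have hη2 : η * (4 * g) ≤ δ := (le_div_iff₀ (by positivity)).1 (hηle.trans (min_le_right _ _))
  have hxδ : x ∈ Metric.ball a δ := Metric.ball_subset_ball (by linarith) hx
  have hgx : ‖grad c x (c x)‖ ≤ g :=
    ((grad c x).le_opNorm _).trans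
      (mul_le_mul (hb x hxδ).2 (hb x hxδ).1 (norm_nonneg _) (by positivity))
  have hproj := hz.2 x hxX
  have e1 : x - η • grad c x (c x) - z = -(z - x) - η • grad c x (c x) := by abel
  have e2 : x - η • grad c x (c x) - x = - (η • grad c x (c x)) := by abel
  rw [e2, norm_neg] at hproj
  have hηg : ‖η • grad c x (c x)‖ ≤ η * g := by
    rw [norm_smul, Real.norm_of_nonneg hη.le]
    exact mul_le_mul_of_nonneg_left hgx hη.le
  have hzx : ‖z - x‖ ≤ 2 * (η * g) := by
    have h1 : z - x = -(x - η • grad c x (c x) - z) - η • grad c x (c x) := by abel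
    rw [h1]
    refine (norm_sub_le _ _).trans ?_
    rw [norm_neg]
    linarith
  have hzδ : z ∈ Metric.ball a δ := by
    rw [Metric.mem_ball, dist_eq_norm] at hx ⊢
    have := norm_add_le (z - x) (x - a)
    rw [sub_add_sub_cancel] at this
    linarith
  -- Expanding the comparison of the nearest point `z` with the competitor `x`. Of the resulting
  -- decrease `1 / (2 * η) * ‖z - x‖ ^ 2`, half absorbs the `M` term and half is what the test asks
  -- for.
  have hin : 2 * η * ⟪grad c x (c x), z - x⟫_ℝ ≤ - ‖z - x‖ ^ 2 := by
    have h2 : ‖x - η • grad c x (c x) - z‖ ^ 2 ≤ ‖η • grad c x (c x)‖ ^ 2 := by gcongr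
    rw [e1, ← neg_add', norm_neg, norm_add_sq_real, real_inner_smul_right, real_inner_comm] at h2
    linarith
  rw [inner_grad_left] at hin
  obtain ⟨hΔ, hR⟩ := hT x hxδ z hzδ
  have hsq : ‖c z‖ ^ 2 = ‖c x‖ ^ 2 + 2 * ⟪c x, c z - c x⟫_ℝ + ‖c z - c x‖ ^ 2 := by
    rw [← norm_add_sq_real, add_sub_cancel]
  have hi2 : ⟪c x, c z - c x⟫_ℝ ≤ ⟪c x, fderiv ℝ c x (z - x)⟫_ℝ
      + (‖c a‖ + 1) * (L * ‖z - x‖ ^ 2) := by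
    have h3 : ⟪c x, c z - c x - fderiv ℝ c x (z - x)⟫_ℝ ≤ (‖c a‖ + 1) * (L * ‖z - x‖ ^ 2) :=
      (real_inner_le_norm _ _).trans
        (mul_le_mul (hb x hxδ).1 hR (norm_nonneg _) (by positivity))
    rw [inner_sub_right] at h3
    linarith
  have hΔ2 : ‖c z - c x‖ ^ 2 ≤ G ^ 2 * ‖z - x‖ ^ 2 := by
    rw [← mul_pow]; gcongr
  have hmain : 1 / 2 * ‖c z‖ ^ 2 ≤ 1 / 2 * ‖c x‖ ^ 2 + ⟪c x, fderiv ℝ c x (z - x)⟫_ℝ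
      + M * ‖z - x‖ ^ 2 := by
    rw [hM]; nlinarith
  have hi3 : ⟪c x, fderiv ℝ c x (z - x)⟫_ℝ ≤ -(1 / (2 * η) * ‖z - x‖ ^ 2) := by
    rw [div_mul_eq_mul_div, ← neg_div, le_div_iff₀ (by positivity)]
    linarith
  have hM1 : M ≤ 1 / (4 * η) := by
    rw [le_div_iff₀ (by positivity)]; nlinarith
  have hM2 : M * ‖z - x‖ ^ 2 ≤ 1 / (4 * η) * ‖z - x‖ ^ 2 := by gcongr
  have hhalf : 1 / (2 * η) = 2 * (1 / (4 * η)) := by field_simp; norm_num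
  rw [hhalf] at hi3
  unfold SufficientDecrease
  linarith

/-- Near any point, the stepsizes found by the line search are bounded away from zero. -/
lemma exists_stepsize_lower_bound {n p : ℕ} {X : Set (EuclideanSpace ℝ (Fin n))}
    {c : EuclideanSpace ℝ (Fin n) → EuclideanSpace ℝ (Fin p)}
    (hc : LocallyLipschitz c) (hc_diff : Differentiable ℝ c)
    (hc_grad : LocallyLipschitz (grad c)) (a : EuclideanSpace ℝ (Fin n)) {ηmax α : ℝ}
    (hη : 0 < ηmax) (hα : 0 < α) (hα1 : α < 1) :
    ∃ δ > 0, ∃ ηlow > 0, ∀ x ∈ X, x ∈ Metric.ball a δ → ∀ x',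
      IsProjectedGradientStep X c ηmax α x x' →
      ∃ η, ηlow ≤ η ∧ η ≤ ηmax ∧ x' ∈ nearestPoints X (x - η • grad c x (c x)) ∧
        SufficientDecrease c η x x' := by
  obtain ⟨δ, hδ, η₀, hη₀, h⟩ := exists_sufficientDecrease (X := X) hc hc_diff hc_grad a
  -- Either the first exponent passes, with stepsize `ηmax`, or the preceding stepsize failed, hence
  -- exceeded `η₀`, and was multiplied by `α`.
  refine ⟨δ, hδ, min ηmax (α * η₀), lt_min hη (by positivity), ?_⟩
  rintro x hxX hx x' ⟨j, z, hz, hdec, hfail, rfl⟩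
  refine ⟨α ^ j * ηmax, ?_, mul_le_of_le_one_left hη.le (pow_le_one₀ hα.le hα1.le),
    hz j le_rfl, hdec⟩
  rcases j with _ | i
  · simp
  · refine (min_le_right _ _).trans ?_
    have h1 : η₀ < α ^ i * ηmax := by
      by_contra! hle
      exact hfail i (Nat.lt_succ_self i) (h x hxX hx _ (by positivity) hle _ (hz i (Nat.le_succ i)))
    rw [pow_succ', mul_assoc]
    exact mul_le_mul_of_nonneg_left h1.le hα.le

/-! ### Elementary properties of the iterates -/

lemma IsHybridSequence.exists_trial {n p : ℕ} {X : Set (EuclideanSpace ℝ (Fin n))}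
    {c : EuclideanSpace ℝ (Fin n) → EuclideanSpace ℝ (Fin p)}
    {Q : EuclideanSpace ℝ (Fin n) → (EuclideanSpace ℝ (Fin n) →L[ℝ] EuclideanSpace ℝ (Fin n))}
    {τ : ℝ≥0 → ℝ≥0} {ξ : EuclideanSpace ℝ (Fin n) → ℝ≥0} {κ ηmax α : ℝ}
    {r x : ℕ → EuclideanSpace ℝ (Fin n)} (h : IsHybridSequence X c Q τ ξ κ ηmax α r x) (k : ℕ) :
    (x (k + 1) ∈ nearestPoints X (x k - newtonDirection c Q τ (x k) + r k) ∧
      ‖c (x (k + 1))‖ < (1 - κ) * ‖c (x k)‖) ∨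
    (∃ z ∈ nearestPoints X (x k - newtonDirection c Q τ (x k) + r k),
      (1 - κ) * ‖c (x k)‖ ≤ ‖c z‖ ∧ IsProjectedGradientStep X c ηmax α (x k) (x (k + 1))) := by
  obtain ⟨z, hz, h1, h2⟩ := h.step k
  rcases lt_or_ge ‖c z‖ ((1 - κ) * ‖c (x k)‖) with hlt | hge
  · left
    rw [h2 hlt]
    exact ⟨hz, hlt⟩
  · exact Or.inr ⟨z, hz, hge, h1 hge⟩

lemma IsProjectedGradientStep.mem {n p : ℕ} {X : Set (EuclideanSpace ℝ (Fin n))}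
    {c : EuclideanSpace ℝ (Fin n) → EuclideanSpace ℝ (Fin p)} {ηmax α : ℝ}
    {x x' : EuclideanSpace ℝ (Fin n)} (h : IsProjectedGradientStep X c ηmax α x x') : x' ∈ X := by
  obtain ⟨j, z, hz, -, -, rfl⟩ := h
  exact (hz j le_rfl).1

lemma IsProjectedGradientStep.norm_sub_sq_le {n p : ℕ} {X : Set (EuclideanSpace ℝ (Fin n))}
    {c : EuclideanSpace ℝ (Fin n) → EuclideanSpace ℝ (Fin p)} {ηmax α : ℝ}
    (hη : 0 < ηmax) (hα : 0 < α) (hα1 : α < 1)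
    {x x' : EuclideanSpace ℝ (Fin n)} (h : IsProjectedGradientStep X c ηmax α x x') :
    ‖x' - x‖ ^ 2 ≤ 2 * ηmax * (‖c x‖ ^ 2 - ‖c x'‖ ^ 2) := by
  obtain ⟨j, z, -, hdec, -, rfl⟩ := h
  unfold SufficientDecrease at hdec
  have h1 : α ^ j * ηmax ≤ ηmax := mul_le_of_le_one_left hη.le (pow_le_one₀ hα.le hα1.le)
  have h2 : 1 / (4 * ηmax) ≤ 1 / (4 * (α ^ j * ηmax)) := by gcongr
  have h3 := mul_le_mul_of_nonneg_right h2 (sq_nonneg ‖z j - x‖)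
  have h4 : 1 / (4 * ηmax) * ‖z j - x‖ ^ 2 ≤ 1 / 2 * (‖c x‖ ^ 2 - ‖c (z j)‖ ^ 2) := by linarith
  rw [div_mul_eq_mul_div, div_le_iff₀ (by positivity)] at h4
  linarith

/-- At a feasible iterate the strict acceptance test always fails, so a gradient step is taken
there; the point being projected is then `x` itself. -/
lemma IsProjectedGradientStep.eq_of_map_eq_zero {n p : ℕ} {X : Set (EuclideanSpace ℝ (Fin n))}
    {c : EuclideanSpace ℝ (Fin n) → EuclideanSpace ℝ (Fin p)} {ηmax α : ℝ}
    {x x' : EuclideanSpace ℝ (Fin n)} (h : IsProjectedGradientStep X c ηmax α x x') (hx : x ∈ X)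
    (hcx : c x = 0) : x' = x := by
  obtain ⟨j, z, hz, -, -, rfl⟩ := h
  have h1 := (hz j le_rfl).2 x hx
  rw [hcx, map_zero, smul_zero, sub_zero, sub_self, norm_zero] at h1
  exact (sub_eq_zero.1 (norm_le_zero_iff.1 h1)).symm

lemma IsHybridSequence.mem {n p : ℕ} {X : Set (EuclideanSpace ℝ (Fin n))}
    {c : EuclideanSpace ℝ (Fin n) → EuclideanSpace ℝ (Fin p)}
    {Q : EuclideanSpace ℝ (Fin n) → (EuclideanSpace ℝ (Fin n) →L[ℝ] EuclideanSpace ℝ (Fin n))}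
    {τ : ℝ≥0 → ℝ≥0} {ξ : EuclideanSpace ℝ (Fin n) → ℝ≥0} {κ ηmax α : ℝ}
    {r x : ℕ → EuclideanSpace ℝ (Fin n)} (h : IsHybridSequence X c Q τ ξ κ ηmax α r x) (k : ℕ) :
    x k ∈ X := by
  cases k with
  | zero => exact h.init
  | succ k =>
    rcases h.exists_trial k with h1 | ⟨_, _, _, h1⟩
    · exact h1.1.1
    · exact h1.mem

lemma IsHybridSequence.antitone_norm {n p : ℕ} {X : Set (EuclideanSpace ℝ (Fin n))}
    {c : EuclideanSpace ℝ (Fin n) → EuclideanSpace ℝ (Fin p)}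
    {Q : EuclideanSpace ℝ (Fin n) → (EuclideanSpace ℝ (Fin n) →L[ℝ] EuclideanSpace ℝ (Fin n))}
    {τ : ℝ≥0 → ℝ≥0} {ξ : EuclideanSpace ℝ (Fin n) → ℝ≥0} {κ ηmax α : ℝ}
    {r x : ℕ → EuclideanSpace ℝ (Fin n)} (h : IsHybridSequence X c Q τ ξ κ ηmax α r x)
    (hκ : 0 < κ) (hη : 0 < ηmax) (hα : 0 < α) (hα1 : α < 1) :
    Antitone fun k => ‖c (x k)‖ := by
  refine antitone_nat_of_succ_le fun k => ?_
  rcases h.exists_trial k with h1 | ⟨_, _, _, h1⟩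
  · nlinarith [h1.2, norm_nonneg (c (x k))]
  · have h2 := h1.norm_sub_sq_le hη hα hα1
    have h3 : 0 ≤ ‖c (x k)‖ ^ 2 - ‖c (x (k + 1))‖ ^ 2 :=
      nonneg_of_mul_nonneg_right ((sq_nonneg _).trans h2) (by positivity)
    exact le_of_sq_le_sq (by linarith) (norm_nonneg _)

/-! ### Feasibility of cluster points -/

/-- Cluster points of projected gradient sequences are stationary, hence feasible under the
nondegeneracy condition. -/
lemma map_eq_zero_of_projectedGradientStep {n p : ℕ} {X : Set (EuclideanSpace ℝ (Fin n))}
    {c : EuclideanSpace ℝ (Fin n) → EuclideanSpace ℝ (Fin p)}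
    (hc : LocallyLipschitz c) (hc_diff : Differentiable ℝ c)
    (hc_grad : LocallyLipschitz (grad c)) {a : EuclideanSpace ℝ (Fin n)}
    (hnd : Nondegenerate X c a) {ηmax α : ℝ} (hη : 0 < ηmax) (hα : 0 < α) (hα1 : α < 1)
    {x : ℕ → EuclideanSpace ℝ (Fin n)} (hxX : ∀ k, x k ∈ X) {l : ℝ}
    (hl : Tendsto (fun k => ‖c (x k)‖) atTop (𝓝 l))
    (hstep : ∀ᶠ k in atTop, IsProjectedGradientStep X c ηmax α (x k) (x (k + 1)))
    (ha : MapClusterPt a atTop x) : c a = 0 := by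
  obtain ⟨δ, hδ, η₀, hη₀, hlow⟩ :=
    exists_stepsize_lower_bound (X := X) hc hc_diff hc_grad a hη hα hα1
  obtain ⟨φ, hφ, hφa⟩ := ha.tendsto_subseq
  have hdiff : Tendsto (fun k => ‖x (k + 1) - x k‖) atTop (𝓝 0) := by
    have h1 : Tendsto (fun k => 2 * ηmax * (‖c (x k)‖ ^ 2 - ‖c (x (k + 1))‖ ^ 2)) atTop (𝓝 0) := by
      have := ((hl.pow 2).sub (((tendsto_add_atTop_iff_nat 1).2 hl).pow 2)).const_mul (2 * ηmax)
      simpa using this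
    have h2 : Tendsto (fun k => ‖x (k + 1) - x k‖ ^ 2) atTop (𝓝 0) :=
      squeeze_zero' (Eventually.of_forall fun _ => sq_nonneg _)
        (hstep.mono fun k hk => hk.norm_sub_sq_le hη hα hα1) h1
    have h3 := (Real.continuous_sqrt.tendsto 0).comp h2
    simpa [Function.comp_def, Real.sqrt_sq (norm_nonneg _)] using h3
  have hev : ∀ᶠ i in atTop, ∃ η, η₀ ≤ η ∧
      x (φ i + 1) ∈ nearestPoints X (x (φ i) - η • grad c (x (φ i)) (c (x (φ i)))) := by
    filter_upwards [hφ.tendsto_atTop.eventually hstep,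
      hφa.eventually (Metric.ball_mem_nhds a hδ)] with i hi hi'
    obtain ⟨η, h1, -, h2, -⟩ := hlow _ (hxX _) hi' _ hi
    exact ⟨η, h1, h2⟩
  obtain ⟨N, hN⟩ := eventually_atTop.1 hev
  choose η hη1 hη2 using fun i : ℕ => hN (i + N) (Nat.le_add_left N i)
  have hshift : Tendsto (fun i : ℕ => i + N) atTop atTop := tendsto_add_atTop_nat N
  have hxa : Tendsto (fun i => x (φ (i + N))) atTop (𝓝 a) := hφa.comp hshift
  have hd : Tendsto (fun i => ‖x (φ (i + N) + 1) - x (φ (i + N))‖) atTop (𝓝 0) :=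
    hdiff.comp (hφ.tendsto_atTop.comp hshift)
  have hy : Tendsto (fun i => x (φ (i + N) + 1)) atTop (𝓝 a) := by
    simpa using (tendsto_zero_iff_norm_tendsto_zero.2 hd).add hxa
  have hg : Tendsto (fun i => grad c (x (φ (i + N))) (c (x (φ (i + N))))) atTop
      (𝓝 (grad c a (c a))) :=
    ((hc_grad.continuous.clm_apply hc.continuous).tendsto a).comp hxa
  have hpos : ∀ i, 0 < η i := fun i => hη₀.trans_le (hη1 i)
  have hv : Tendsto (fun i => (η i)⁻¹ • (x (φ (i + N)) - x (φ (i + N) + 1))) atTop (𝓝 0) := by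
    rw [tendsto_zero_iff_norm_tendsto_zero]
    refine squeeze_zero (fun _ => norm_nonneg _) (fun i => ?_) (by simpa using hd.const_mul η₀⁻¹)
    rw [norm_smul, norm_sub_rev, Real.norm_of_nonneg (inv_nonneg.2 (hpos i).le)]
    exact mul_le_mul_of_nonneg_right (inv_anti₀ hη₀ (hη1 i)) (norm_nonneg _)
  -- The scaled projection residuals are regular normals at the new iterates. They equal a scaled
  -- increment, which vanishes because stepsizes stay above `η₀`, minus the gradient.
  have hmem : -grad c a (c a) ∈ limitingNormalCone X a := by
    refine ⟨fun i => x (φ (i + N) + 1), fun i => (η i)⁻¹ •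
      (x (φ (i + N)) - η i • grad c (x (φ (i + N))) (c (x (φ (i + N)))) - x (φ (i + N) + 1)),
      fun i => hxX _, fun i => smul_sub_mem_regularNormalCone (hη2 i) (inv_nonneg.2 (hpos i).le),
      hy, ?_⟩
    have h1 := hv.sub hg
    rw [zero_sub] at h1
    refine h1.congr fun i => ?_
    rw [sub_right_comm, smul_sub (η i)⁻¹ (_ - _) (η i • _), inv_smul_smul₀ (hpos i).ne']
  refine hnd.eq_zero ?_
  rw [← Submodule.neg_mem_iff]
  exact Submodule.subset_span hmem

lemma IsHybridSequence.map_eq_zero {n p : ℕ} {X : Set (EuclideanSpace ℝ (Fin n))}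
    {c : EuclideanSpace ℝ (Fin n) → EuclideanSpace ℝ (Fin p)}
    {Q : EuclideanSpace ℝ (Fin n) → (EuclideanSpace ℝ (Fin n) →L[ℝ] EuclideanSpace ℝ (Fin n))}
    {τ : ℝ≥0 → ℝ≥0} {ξ : EuclideanSpace ℝ (Fin n) → ℝ≥0} {κ ηmax α : ℝ}
    {r x : ℕ → EuclideanSpace ℝ (Fin n)} (h : IsHybridSequence X c Q τ ξ κ ηmax α r x)
    (hc : LocallyLipschitz c) (hc_diff : Differentiable ℝ c) (hc_grad : LocallyLipschitz (grad c))
    {a : EuclideanSpace ℝ (Fin n)} (hnd : Nondegenerate X c a)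
    (hκ : 0 < κ) (hη : 0 < ηmax) (hα : 0 < α) (hα1 : α < 1) (ha : MapClusterPt a atTop x) :
    c a = 0 ∧ Tendsto (fun k => ‖c (x k)‖) atTop (𝓝 0) := by
  have hanti := h.antitone_norm hκ hη hα hα1
  have hl := tendsto_atTop_ciInf hanti ⟨0, by rintro _ ⟨k, rfl⟩; exact norm_nonneg _⟩
  set l := ⨅ k, ‖c (x k)‖
  obtain ⟨φ, hφ, hφa⟩ := ha.tendsto_subseq
  have hcl : ‖c a‖ = l :=
    tendsto_nhds_unique ((hc.continuous.norm.tendsto a).comp hφa) (hl.comp hφ.tendsto_atTop)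
  have hca : c a = 0 := by
    by_cases hfr : ∃ᶠ k in atTop, ‖c (x (k + 1))‖ < (1 - κ) * ‖c (x k)‖
    · have h1 : l ≤ (1 - κ) * l := by
        by_contra! hlt
        refine hfr ?_
        filter_upwards [(hl.const_mul (1 - κ)).eventually_lt
          ((tendsto_add_atTop_iff_nat 1).2 hl) hlt] with k hk
        exact not_lt.2 hk.le
      rw [← norm_le_zero_iff, hcl]
      nlinarith
    · refine map_eq_zero_of_projectedGradientStep hc hc_diff hc_grad hnd hη hα hα1 h.mem hl ?_ ha
      rw [not_frequently] at hfr
      filter_upwards [hfr] with k hk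
      rcases h.exists_trial k with h1 | ⟨_, _, _, h1⟩
      · exact absurd h1.2 hk
      · exact h1
  refine ⟨hca, ?_⟩
  rwa [← hcl, hca, norm_zero] at hl

/-! ### The normal matrix and the trial step -/

lemma ContinuousLinearMap.IsPositive.map_eq_zero_of_inner_eq_zero {E : Type*}
    [NormedAddCommGroup E] [InnerProductSpace ℝ E] {T : E →L[ℝ] E} (hT : T.IsPositive) {v : E}
    (hv : ⟪T v, v⟫_ℝ = 0) : T v = 0 := by
  -- Positivity along `v + t • T v` gives a nonnegative quadratic in `t` with zero constant term, so
  -- its linear coefficient vanishes.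
  have h1 : ∀ t : ℝ, 0 ≤ ⟪T (T v), T v⟫_ℝ * (t * t) + (2 * ⟪T v, T v⟫_ℝ) * t + 0 := by
    intro t
    have h2 := hT.inner_nonneg_left (v + t • T v)
    rw [map_add, map_smul, inner_add_left, inner_add_right, inner_add_right, real_inner_smul_left,
      real_inner_smul_left, real_inner_smul_right, real_inner_smul_right, hv,
      hT.inner_left_eq_inner_right (T v) v] at h2
    linarith
  have h3 := discrim_le_zero h1
  rw [discrim] at h3
  have h4 : ⟪T v, T v⟫_ℝ = 0 := by nlinarith
  exact inner_self_eq_zero.1 h4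

/-- A kernel vector `y` makes both nonnegative parts of the quadratic form vanish, so `grad c x y`
lies in `ker Q`, the span of the normals, and nondegeneracy applies. Positivity of `τ` plays no
role, which matters at feasible points. -/
lemma IsProjectiveMapping.isUnit_normalMatrix {n p : ℕ} {X : Set (EuclideanSpace ℝ (Fin n))}
    {Q : EuclideanSpace ℝ (Fin n) → (EuclideanSpace ℝ (Fin n) →L[ℝ] EuclideanSpace ℝ (Fin n))}
    (hQ : IsProjectiveMapping X Q) {c : EuclideanSpace ℝ (Fin n) → EuclideanSpace ℝ (Fin p)}
    (τ : ℝ≥0 → ℝ≥0) {x : EuclideanSpace ℝ (Fin n)} (hx : x ∈ X) (hnd : Nondegenerate X c x) :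
    IsUnit (normalMatrix c Q τ x) := by
  have hinj : Function.Injective
      (normalMatrix c Q τ x : EuclideanSpace ℝ (Fin p) →ₗ[ℝ] EuclideanSpace ℝ (Fin p)) := by
    rw [← LinearMap.ker_eq_bot, LinearMap.ker_eq_bot']
    intro y hy
    have h1 : ⟪normalMatrix c Q τ x y, y⟫_ℝ = 0 := by
      rw [show normalMatrix c Q τ x y = 0 from hy, inner_zero_left]
    have h2 : ⟪normalMatrix c Q τ x y, y⟫_ℝ =
        ⟪Q x (grad c x y), grad c x y⟫_ℝ + τ ‖c x‖₊ * ⟪y, y⟫_ℝ := by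
      simp only [normalMatrix, add_apply, ContinuousLinearMap.comp_apply,
        smul_apply, ContinuousLinearMap.id_apply, inner_add_left,
        real_inner_smul_left, ContinuousLinearMap.adjoint_inner_left]
    have h3 := (hQ.posSemidef x hx).inner_nonneg_left (grad c x y)
    have h4 : 0 ≤ (τ ‖c x‖₊ : ℝ) * ⟪y, y⟫_ℝ := mul_nonneg (τ ‖c x‖₊).2 real_inner_self_nonneg
    refine hnd.eq_zero ?_
    rw [← hQ.null_eq x hx]
    exact (hQ.posSemidef x hx).map_eq_zero_of_inner_eq_zero (by linarith)
  rw [ContinuousLinearMap.isUnit_iff_bijective]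
  exact ⟨hinj, LinearMap.injective_iff_surjective.1 hinj⟩

lemma norm_sub_le_infDist_of_mem_nearestPoints {n : ℕ} {X : Set (EuclideanSpace ℝ (Fin n))}
    {w z : EuclideanSpace ℝ (Fin n)} (hz : z ∈ nearestPoints X w) :
    ‖w - z‖ ≤ Metric.infDist w X := by
  refine (Metric.le_infDist ⟨z, hz.1⟩).2 fun y hy => ?_
  rw [dist_eq_norm]
  exact hz.2 y hy

/-- Near a feasible point, the trial point is at distance `O(‖c x‖)` and its constraint violation
is `O(‖c x‖²)`. -/
lemma exists_local_trial_bounds {n p : ℕ} {X : Set (EuclideanSpace ℝ (Fin n))}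
    {c : EuclideanSpace ℝ (Fin n) → EuclideanSpace ℝ (Fin p)}
    {Q : EuclideanSpace ℝ (Fin n) → (EuclideanSpace ℝ (Fin n) →L[ℝ] EuclideanSpace ℝ (Fin n))}
    {τ : ℝ≥0 → ℝ≥0} {ξ : EuclideanSpace ℝ (Fin n) → ℝ≥0} (hX : IsClosed X)
    (hc : LocallyLipschitz c) (hc_diff : Differentiable ℝ c) (hc_grad : LocallyLipschitz (grad c))
    (hQ : IsProjectiveMapping X Q) (hτ : LocallyLipschitz τ) (hτ_zero : τ 0 = 0)
    (hξ : ∀ S : Set (EuclideanSpace ℝ (Fin n)), IsCompact S → BddAbove (ξ '' S))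
    {a : EuclideanSpace ℝ (Fin n)} (haX : a ∈ X) (hca : c a = 0)
    (hnd : ∀ x ∈ X, Nondegenerate X c x) :
    ∃ δ > 0, ∃ D ≥ 0, ∃ A ≥ 0, ∀ x ∈ X, x ∈ Metric.ball a δ → ∀ r : EuclideanSpace ℝ (Fin n),
      ‖r‖ ≤ ξ x * ‖c x‖ ^ 2 → ∀ z ∈ nearestPoints X (x - newtonDirection c Q τ x + r),
        ‖z - x‖ ≤ D * ‖c x‖ ∧ ‖c z‖ ≤ A * ‖c x‖ ^ 2 := by
  obtain ⟨δ, hδ, G, hG, L, hL, hb, hT⟩ := exists_local_taylor_bounds hc hc_diff hc_grad a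
  obtain ⟨K, t, ht, hK⟩ := hτ 0
  obtain ⟨ρ, hρ, hdist⟩ := hQ.dist_le
  obtain ⟨Ξ, hΞ⟩ := hξ _ (isCompact_closedBall a 1)
  obtain ⟨R, hR⟩ := hρ (X ∩ Metric.closedBall a 1) Set.inter_subset_left
    ((isCompact_closedBall a 1).inter_left hX)
  have hcont : ContinuousWithinAt (normalMatrix c Q τ) X a := by
    have hgc : ContinuousWithinAt (grad c) X a := hc_grad.continuous.continuousWithinAt
    have hadj : ContinuousWithinAt (fun x => ContinuousLinearMap.adjoint (grad c x)) X a :=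
      (ContinuousLinearMap.adjoint.continuous.comp hc_grad.continuous).continuousWithinAt
    have hτc : Continuous fun x => (τ ‖c x‖₊ : ℝ) :=
      NNReal.continuous_coe.comp (hτ.continuous.comp hc.continuous.nnnorm)
    exact (hadj.clm_comp ((hQ.continuousOn a haX).clm_comp hgc)).add
      (hτc.continuousWithinAt.smul continuousWithinAt_const)
  obtain ⟨U, hU⟩ := hQ.isUnit_normalMatrix τ haX (hnd a haX)
  have hinv : ContinuousWithinAt (fun x => Ring.inverse (normalMatrix c Q τ x)) X a := by
    refine ContinuousAt.comp_continuousWithinAt (g := Ring.inverse) ?_ hcont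
    rw [← hU]
    exact NormedRing.inverse_continuousAt U
  set m := ‖Ring.inverse (normalMatrix c Q τ a)‖ + 1
  set q := ‖Q a‖ + 1
  set g := ‖grad c a‖ + 1
  -- `E` bounds the distance from `z` to the unperturbed point `x - Q x v`. The error `r` counts
  -- twice: it shifts the projected point and changes that point's distance to `X`. `D` adds the
  -- length of `Q x v`.
  set E : ℝ := R * (g * m) ^ 2 + 2 * Ξ with hE
  set D : ℝ := q * (g * m) + E with hD
  have hm0 : 0 < m := by positivity
  have hq0 : 0 < q := by positivity
  have hg0 : 0 < g := by positivity
  have hE0 : 0 ≤ E := by positivity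
  have hD0 : 0 ≤ D := by positivity
  have hcc : ContinuousWithinAt (fun x => ‖c x‖) X a := hc.continuous.norm.continuousWithinAt
  have hca' : ‖c a‖ = 0 := by rw [hca, norm_zero]
  have E1 : ∀ᶠ x in 𝓝[X] a, ‖Ring.inverse (normalMatrix c Q τ x)‖ < m :=
    hinv.norm.eventually_lt_const (lt_add_one _)
  have E2 : ∀ᶠ x in 𝓝[X] a, ‖Q x‖ < q := (hQ.continuousOn a haX).norm.eventually_lt_const
    (lt_add_one _)
  have E3 : ∀ᶠ x in 𝓝[X] a, (τ ‖c x‖₊ : ℝ) ≤ K * ‖c x‖ := by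
    have h1 : Tendsto (fun x => ‖c x‖₊) (𝓝[X] a) (𝓝 0) := by
      have := hc.continuous.nnnorm.continuousWithinAt (s := X) (x := a)
      rwa [ContinuousWithinAt, hca, nnnorm_zero] at this
    filter_upwards [h1 ht] with x hx
    have h2 := hK.dist_le_mul _ hx 0 (mem_of_mem_nhds ht)
    simpa [hτ_zero, NNReal.dist_eq] using h2
  have E4 : ∀ᶠ x in 𝓝[X] a, x ∈ Metric.ball a (min (δ / 2) 1) :=
    mem_nhdsWithin_of_mem_nhds (Metric.ball_mem_nhds _ (by positivity))
  -- The thresholds give, in turn, `‖v‖ ≤ 1` for the projective estimate, `‖c x‖ ^ 2 ≤ ‖c x‖`, and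
  -- `z` in the Taylor ball.
  have E5 : ∀ᶠ x in 𝓝[X] a, ‖c x‖ < min (min (1 / (g * m)) 1) (δ / 2 / (D + 1)) :=
    hcc.eventually_lt_const (by
      change ‖c a‖ < _
      rw [hca']
      positivity)
  obtain ⟨δ', hδ', hall⟩ := Metric.mem_nhdsWithin_iff.1
    (E1.and (E2.and (E3.and (E4.and E5))))
  refine ⟨δ', hδ', D, hD0, L * D ^ 2 + g * E + K * m, by positivity, ?_⟩
  intro x hxX hx r hr z hz
  obtain ⟨h1, h2, h3, h4, h5⟩ := hall ⟨hx, hxX⟩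
  obtain ⟨h5', h5c⟩ := lt_min_iff.1 h5
  obtain ⟨h5a, h5b⟩ := lt_min_iff.1 h5'
  have hxδ : x ∈ Metric.ball a (δ / 2) := Metric.ball_subset_ball (min_le_left _ _) h4
  have hx1 : x ∈ Metric.closedBall a 1 :=
    Metric.ball_subset_closedBall (Metric.ball_subset_ball (min_le_right _ _) h4)
  have hxδ' : x ∈ Metric.ball a δ := Metric.ball_subset_ball (by linarith) hxδ
  have hξx : (ξ x : ℝ) ≤ Ξ := by exact_mod_cast hΞ ⟨x, hx1, rfl⟩
  have hρx : (ρ x : ℝ) ≤ R := by exact_mod_cast hR ⟨x, ⟨hxX, hx1⟩, rfl⟩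
  set y := (normalMatrix c Q τ x).inverse (c x) with hy
  have hyn : ‖y‖ ≤ m * ‖c x‖ := by
    rw [hy, ← ContinuousLinearMap.ringInverse_eq_inverse]
    exact (ContinuousLinearMap.le_opNorm _ _).trans
      (mul_le_mul_of_nonneg_right h1.le (norm_nonneg _))
  have hyeq : fderiv ℝ c x (Q x (grad c x y)) + (τ ‖c x‖₊ : ℝ) • y = c x := by
    have hu := hQ.isUnit_normalMatrix τ hxX (hnd x hxX)
    have h6 := DFunLike.congr_fun (Ring.mul_inverse_cancel _ hu) (c x)
    rw [ContinuousLinearMap.ringInverse_eq_inverse] at h6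
    have h7 : normalMatrix c Q τ x y = c x := h6
    have h8 : normalMatrix c Q τ x y =
        fderiv ℝ c x (Q x (grad c x y)) + (τ ‖c x‖₊ : ℝ) • y := by
      simp [normalMatrix, grad]
    rw [← h8, h7]
  set v := grad c x y with hv
  have hgx : ‖grad c x‖ ≤ g := (hb x hxδ').2
  have hvn : ‖v‖ ≤ g * m * ‖c x‖ := by
    rw [mul_assoc]
    exact (ContinuousLinearMap.le_opNorm _ _).trans
      (mul_le_mul hgx hyn (norm_nonneg _) hg0.le)
  have hv1 : ‖v‖ ≤ 1 := by
    rw [lt_div_iff₀ (by positivity)] at h5a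
    linarith
  have hd : newtonDirection c Q τ x = Q x v := rfl
  rw [hd] at hz
  have hdX : Metric.infDist (x - Q x v) X ≤ R * (g * m) ^ 2 * ‖c x‖ ^ 2 := by
    have h6 := hdist x hxX (-v) (by rwa [norm_neg])
    rw [map_neg, ← sub_eq_add_neg, norm_neg] at h6
    refine h6.trans ?_
    rw [mul_assoc, ← mul_pow]
    gcongr
  have hrn : ‖r‖ ≤ Ξ * ‖c x‖ ^ 2 := hr.trans (mul_le_mul_of_nonneg_right hξx (sq_nonneg _))
  have hzw : ‖z - (x - Q x v)‖ ≤ E * ‖c x‖ ^ 2 := by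
    have h6 := norm_sub_le_infDist_of_mem_nearestPoints hz
    have h7 := Metric.infDist_le_infDist_add_dist (s := X) (x := x - Q x v + r) (y := x - Q x v)
    rw [dist_eq_norm, add_sub_cancel_left] at h7
    have h8 : z - (x - Q x v) = r - (x - Q x v + r - z) := by abel
    rw [h8]
    refine (norm_sub_le _ _).trans ?_
    rw [hE]
    linarith
  have hQv : ‖Q x v‖ ≤ q * (g * m) * ‖c x‖ := by
    rw [mul_assoc]
    exact (ContinuousLinearMap.le_opNorm _ _).trans
      (mul_le_mul h2.le hvn (norm_nonneg _) hq0.le)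
  have hcsq : ‖c x‖ ^ 2 ≤ ‖c x‖ := 
    pow_le_of_le_one (norm_nonneg _) h5b.le two_ne_zero
  have hzx : ‖z - x‖ ≤ D * ‖c x‖ := by
    have h8 : z - x = (z - (x - Q x v)) - Q x v := by abel
    rw [h8]
    refine (norm_sub_le _ _).trans ?_
    have h9 := mul_le_mul_of_nonneg_left hcsq hE0
    rw [hD]
    linarith
  refine ⟨hzx, ?_⟩
  have hzδ : z ∈ Metric.ball a δ := by
    rw [Metric.mem_ball, dist_eq_norm] at hxδ ⊢
    rw [lt_div_iff₀ (by positivity)] at h5c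
    have h10 := norm_add_le (z - x) (x - a)
    rw [sub_add_sub_cancel] at h10
    have h11 : D * ‖c x‖ ≤ ‖c x‖ * (D + 1) := by
      rw [mul_comm]
      exact mul_le_mul_of_nonneg_left (by linarith only) (norm_nonneg _)
    linarith only [h10, h11, hzx, hxδ, h5c]
  have hfd : ‖fderiv ℝ c x‖ ≤ g := by
    rwa [grad, LinearIsometryEquiv.norm_map] at hgx
  have hR1 : ‖c z - c x - fderiv ℝ c x (z - x)‖ ≤ L * D ^ 2 * ‖c x‖ ^ 2 := by
    refine (hT x hxδ' z hzδ).2.trans ?_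
    rw [mul_assoc, ← mul_pow]
    gcongr
  have hR2 : ‖fderiv ℝ c x (z - (x - Q x v))‖ ≤ g * E * ‖c x‖ ^ 2 := by
    rw [mul_assoc]
    exact (ContinuousLinearMap.le_opNorm _ _).trans
      (mul_le_mul hfd hzw (norm_nonneg _) hg0.le)
  have hR3 : ‖(τ ‖c x‖₊ : ℝ) • y‖ ≤ K * m * ‖c x‖ ^ 2 := by
    rw [norm_smul, Real.norm_of_nonneg (NNReal.coe_nonneg _)]
    calc _ ≤ K * ‖c x‖ * (m * ‖c x‖) := mul_le_mul h3 hyn (norm_nonneg _) (by positivity)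
      _ = _ := by ring
  -- The linearization along `Q x v` cancels `c x` up to the regularization term; all three
  -- remaining terms are quadratic in `‖c x‖`.
  have hsplit : c z = (c z - c x - fderiv ℝ c x (z - x)) + fderiv ℝ c x (z - (x - Q x v))
      + (τ ‖c x‖₊ : ℝ) • y := by
    have h8 : z - (x - Q x v) = (z - x) + Q x v := by abel
    have h9 : (τ ‖c x‖₊ : ℝ) • y = c x - fderiv ℝ c x (Q x v) := eq_sub_of_add_eq' hyeq
    rw [h8, map_add, h9]
    abel
  rw [hsplit]
  refine norm_add₃_le.trans ?_
  linarith

/-! ### Local convergence and rates -/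

/-- A sequence with geometrically controlled increments near a cluster point stays near it and is
controlled by the tail of the increments. -/
lemma eventually_norm_sub_le_of_mapClusterPt {E : Type*} [NormedAddCommGroup E] {x : ℕ → E}
    {e : ℕ → ℝ} {a : E} {δ D η : ℝ} (hδ : 0 < δ) (hD : 0 ≤ D) (hη : 0 < η) (he : ∀ k, 0 ≤ e k)
    (hstep : ∀ k, x k ∈ Metric.ball a δ → e k ≤ η →
      ‖x (k + 1) - x k‖ ≤ D * e k ∧ e (k + 1) ≤ e k / 2)
    (he0 : Tendsto e atTop (𝓝 0)) (ha : MapClusterPt a atTop x) :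
    ∀ᶠ k in atTop, x k ∈ Metric.ball a δ ∧ ‖x k - a‖ ≤ 2 * D * e k := by
  obtain ⟨N, hN⟩ := eventually_atTop.1 (he0.eventually_le_const hη)
  have h1 : ∀ᶠ k in atTop, 2 * D * e k < δ / 2 := by
    have := he0.const_mul (2 * D)
    rw [mul_zero] at this
    exact this.eventually_lt_const (by positivity)
  obtain ⟨k₀, hk₀, hk₀e, hk₀N⟩ := ((ha.frequently
    (Metric.ball_mem_nhds a (half_pos hδ))).and_eventually
    (h1.and (eventually_ge_atTop N))).exists
  rw [dist_eq_norm] at hk₀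
  -- Halving gives `D * e m ≤ 2 * D * (e m - e (m + 1))`, so increments telescope. Staying in the
  -- ball is proved in the same induction, since `hstep` needs it.
  have h2 : ∀ m, k₀ ≤ m → x m ∈ Metric.ball a δ ∧ ‖x m - x k₀‖ ≤ 2 * D * (e k₀ - e m) := by
    intro m hm
    induction m, hm using Nat.le_induction with
    | base =>
      refine ⟨?_, by simp⟩
      rw [Metric.mem_ball, dist_eq_norm]
      linarith
    | succ m hm ih =>
      obtain ⟨h3, h4⟩ := hstep m ih.1 (hN m (hk₀N.trans hm))
      have h5 := norm_add_le (x (m + 1) - x m) (x m - x k₀)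
      rw [sub_add_sub_cancel] at h5
      have h6 : ‖x (m + 1) - x k₀‖ ≤ 2 * D * (e k₀ - e (m + 1)) := by
        nlinarith [mul_le_mul_of_nonneg_left h4 hD]
      refine ⟨?_, h6⟩
      have h7 := norm_add_le (x (m + 1) - x k₀) (x k₀ - a)
      rw [sub_add_sub_cancel] at h7
      rw [Metric.mem_ball, dist_eq_norm]
      nlinarith [mul_nonneg hD (he (m + 1))]
  have h3 : ∀ k, k₀ ≤ k → ∀ m, k ≤ m → ‖x m - x k‖ ≤ 2 * D * (e k - e m) := by
    intro k hk m hm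
    induction m, hm using Nat.le_induction with
    | base => simp
    | succ m hm ih =>
      obtain ⟨h3, h4⟩ := hstep m (h2 m (hk.trans hm)).1 (hN m (hk₀N.trans (hk.trans hm)))
      have h5 := norm_add_le (x (m + 1) - x m) (x m - x k)
      rw [sub_add_sub_cancel] at h5
      nlinarith [mul_le_mul_of_nonneg_left h4 hD]
  filter_upwards [eventually_ge_atTop k₀] with k hk
  refine ⟨(h2 k hk).1, ?_⟩
  obtain ⟨φ, hφ, hφa⟩ := ha.tendsto_subseq
  rw [norm_sub_rev]
  refine le_of_tendsto (hφa.sub_const (x k)).norm ?_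
  filter_upwards [hφ.tendsto_atTop.eventually (eventually_ge_atTop k)] with i hi
  refine (h3 k hk _ hi).trans ?_
  nlinarith [mul_nonneg hD (he (φ i))]

theorem mainTheorem3 (n p : ℕ) (X : Set (EuclideanSpace ℝ (Fin n)))
    (c : EuclideanSpace ℝ (Fin n) → EuclideanSpace ℝ (Fin p))
    (Q : EuclideanSpace ℝ (Fin n) →
      (EuclideanSpace ℝ (Fin n) →L[ℝ] EuclideanSpace ℝ (Fin n)))
    (τ : ℝ≥0 → ℝ≥0) (ξ : EuclideanSpace ℝ (Fin n) → ℝ≥0)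
    (hX : IsClosed X)
    (hc : LocallyLipschitz c) (hc_diff : Differentiable ℝ c)
    (hc_grad : LocallyLipschitz (grad c))
    (hQ : IsProjectiveMapping X Q)
    (hτ : LocallyLipschitz τ) (hτ_mono : StrictMono τ) (hτ_zero : τ 0 = 0)
    (hξ : ∀ S : Set (EuclideanSpace ℝ (Fin n)), IsCompact S → BddAbove (ξ '' S))
    (hnondeg : ∀ x ∈ X, Nondegenerate X c x) :
    ∃ C : EuclideanSpace ℝ (Fin n) → ℝ,
      ∀ (κ ηmax α : ℝ) (r x : ℕ → EuclideanSpace ℝ (Fin n)),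
        0 < κ → κ < 1 → 0 < ηmax → 0 < α → α < 1 →
        IsHybridSequence X c Q τ ξ κ ηmax α r x →
        (∃ xbar, MapClusterPt xbar atTop x) →
        ∃ xstar ∈ {y | y ∈ X ∧ c y = 0},
          Tendsto x atTop (𝓝 xstar) ∧
          ∀ᶠ k in atTop,
            ‖x (k + 1) - xstar‖ ≤ C xstar * ‖x k - xstar‖ ^ 2 ∧
            Metric.infDist (x (k + 1)) {y | y ∈ X ∧ c y = 0} ≤
              C xstar * Metric.infDist (x k) {y | y ∈ X ∧ c y = 0} ^ 2 := by
  -- `C` is chosen from `a` alone, before `κ`, `ηmax`, `α` and the sequence; only how large `k` must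
  -- be depends on these.
  have hlocal : ∀ a, ∃ C : ℝ, a ∈ X → c a = 0 →
      ∀ (κ ηmax α : ℝ) (r x : ℕ → EuclideanSpace ℝ (Fin n)), κ < 1 →
        IsHybridSequence X c Q τ ξ κ ηmax α r x → MapClusterPt a atTop x →
        Tendsto (fun k => ‖c (x k)‖) atTop (𝓝 0) →
          Tendsto x atTop (𝓝 a) ∧ ∀ᶠ k in atTop,
            ‖x (k + 1) - a‖ ≤ C * ‖x k - a‖ ^ 2 ∧
            Metric.infDist (x (k + 1)) {y | y ∈ X ∧ c y = 0} ≤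
              C * Metric.infDist (x k) {y | y ∈ X ∧ c y = 0} ^ 2 := by
    intro a
    by_cases haX : a ∈ X
    swap
    · exact ⟨0, fun h => absurd h haX⟩
    by_cases hca : c a = 0
    swap
    · exact ⟨0, fun _ h => absurd h hca⟩
    obtain ⟨δ₁, hδ₁, G, hG, L, -, -, hT⟩ := exists_local_taylor_bounds hc hc_diff hc_grad a
    obtain ⟨δ₂, hδ₂, D, hD, A, hA, htrial⟩ := exists_local_trial_bounds hX hc hc_diff hc_grad hQ
      hτ hτ_zero hξ haX hca hnondeg
    refine ⟨2 * D * A * G ^ 2, fun _ _ κ ηmax α r x hκ1 hx ha he0 => ?_⟩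
    have hκ' : 0 < 1 - κ := by linarith
    -- Below this threshold the quadratic bound gives at once halving of the residual (the `1`) and
    -- acceptance of the trial point (the `1 - κ`).
    set η := min 1 (1 - κ) / (2 * (A + 1)) with hη
    have hη0 : 0 < η := by positivity
    have hAη : ∀ k, ‖c (x k)‖ ≤ η →
        A * ‖c (x k)‖ ^ 2 ≤ min 1 (1 - κ) / 2 * ‖c (x k)‖ := by
      intro k hk
      rw [hη, le_div_iff₀ (by positivity)] at hk
      rw [sq, ← mul_assoc]
      exact mul_le_mul_of_nonneg_right (by nlinarith [norm_nonneg (c (x k))]) (norm_nonneg _)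
    have hquad : ∀ k, x k ∈ Metric.ball a δ₂ → ‖c (x k)‖ ≤ η →
        ‖x (k + 1) - x k‖ ≤ D * ‖c (x k)‖ ∧ ‖c (x (k + 1))‖ ≤ A * ‖c (x k)‖ ^ 2 := by
      intro k hk hke
      rcases hx.exists_trial k with h1 | ⟨z, hz, h1, h2⟩
      · exact htrial _ (hx.mem k) hk _ (hx.error_le k) _ h1.1
      -- Rejection contradicts the threshold unless the residual is zero, in which case the iterate
      -- does not move.
      · have h3 := (htrial _ (hx.mem k) hk _ (hx.error_le k) _ hz).2
        have h4 := hAη k hke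
        have h5 : ‖c (x k)‖ = 0 := by
          refine le_antisymm ?_ (norm_nonneg _)
          have h6 : min 1 (1 - κ) / 2 * ‖c (x k)‖ ≤ (1 - κ) / 2 * ‖c (x k)‖ := by
            gcongr
            exact min_le_right _ _
          have h7 : (1 - κ) * ‖c (x k)‖ ≤ 0 := by linarith
          by_contra! h8
          exact absurd h7 (not_le.2 (mul_pos hκ' h8))
        rw [h2.eq_of_map_eq_zero (hx.mem k) (norm_eq_zero.1 h5), h5]
        simp
    have htail := eventually_norm_sub_le_of_mapClusterPt (e := fun k => ‖c (x k)‖) hδ₂ hD hη0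
      (fun k => norm_nonneg _) (fun k hk hke => ⟨(hquad k hk hke).1, by
        refine (hquad k hk hke).2.trans ((hAη k hke).trans ?_)
        have h1 : min 1 (1 - κ) ≤ 1 := min_le_left _ _
        nlinarith [norm_nonneg (c (x k))]⟩) he0 ha
    have hlim : Tendsto x atTop (𝓝 a) := by
      rw [tendsto_iff_norm_sub_tendsto_zero]
      refine squeeze_zero' (Eventually.of_forall fun _ => norm_nonneg _)
        (htail.mono fun k hk => hk.2) ?_
      simpa using he0.const_mul (2 * D)
    refine ⟨hlim, ?_⟩
    have hclosed : IsClosed {y | y ∈ X ∧ c y = 0} :=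
      hX.inter (isClosed_singleton.preimage hc.continuous)
    filter_upwards [htail, (tendsto_add_atTop_nat 1).eventually htail,
      he0.eventually_le_const hη0, hlim.eventually (Metric.ball_mem_nhds a (half_pos hδ₁))]
      with k hk hk1 hke hkδ
    have hkδ' : x k ∈ Metric.ball a δ₁ := Metric.ball_subset_ball (by linarith) hkδ
    have h1 : ‖x (k + 1) - a‖ ≤ 2 * D * A * ‖c (x k)‖ ^ 2 := by
      refine hk1.2.trans ?_
      rw [mul_assoc (2 * D)]
      exact mul_le_mul_of_nonneg_left (hquad k hk.1 hke).2 (by positivity)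
    have h2 : ∀ y ∈ Metric.ball a δ₁, c y = 0 → ‖c (x k)‖ ≤ G * ‖x k - y‖ := by
      intro y hy hcy
      have h3 := (hT y hy (x k) hkδ').1
      rwa [hcy, sub_zero] at h3
    have h3 : ∀ y ∈ Metric.ball a δ₁, c y = 0 →
        ‖x (k + 1) - a‖ ≤ 2 * D * A * G ^ 2 * ‖x k - y‖ ^ 2 := by
      intro y hy hcy
      refine h1.trans ?_
      rw [mul_assoc (2 * D * A), ← mul_pow]
      have := h2 y hy hcy
      gcongr
    refine ⟨h3 a (Metric.mem_ball_self hδ₁) hca, ?_⟩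
    -- A nearest feasible `y` is no farther from `x k` than `a` is, hence within `δ₁` of `a`, where
    -- the Lipschitz bound on `c` holds.
    obtain ⟨y, hyK, hy⟩ := hclosed.exists_infDist_eq_dist ⟨a, haX, hca⟩ (x k)
    have hle := Metric.infDist_le_dist_of_mem (x := x k) (show a ∈ {y | y ∈ X ∧ c y = 0} from
      ⟨haX, hca⟩)
    have hyδ : y ∈ Metric.ball a δ₁ := by
      rw [Metric.mem_ball]
      have := dist_triangle_left y a (x k)
      linarith
    rw [hy, dist_eq_norm]
    refine le_trans ?_ (h3 y hyδ hyK.2)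
    rw [← dist_eq_norm]
    exact Metric.infDist_le_dist_of_mem ⟨haX, hca⟩
  choose C hC using hlocal
  refine ⟨C, fun κ ηmax α r x hκ hκ1 hη hα hα1 hx ⟨a, ha⟩ => ?_⟩
  have haX : a ∈ X := hX.mem_of_mapClusterPt ha (Eventually.of_forall hx.mem)
  obtain ⟨hca, he0⟩ := hx.map_eq_zero hc hc_diff hc_grad (hnondeg a haX) hκ hη hα hα1 ha
  exact ⟨a, ⟨haX, hca⟩, hC a haX hca κ ηmax α r x hκ1 hx ha he0⟩
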